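/- Let $A$ be a (not necessarily unital) pro-$C^*$-algebra, i.e. a complete Hausdorff topological $*$-algebra over $\mathbb{C}$ whose topology is given by the family $S(A)$ of its continuous $C^*$-seminorms, with the order in which $a\le b$ if and only if $b-a=c^*c$ for some $c\in A$. Let $E$ be a Hilbert $A$-module: a complex vector space and compatible right $A$-module with an $A$-valued inner product (linear in the second variable, $\langle\xi,\eta\rangle^*=\langle\eta,\xi\rangle$, $\langle\xi,\xi\rangle\ge 0$, and $\langle\xi,\xi\rangle=0$ only for $\xi=0$), complete for the seminorms $\xi\mapsto p(\langle\xi,\xi\rangle)^{1/2}$, $p\in S(A)$. Let $M(E)=L(A,E)$ be the set of adjointable module morphisms $A\to E$, where $A$ carries $\langle a,b\rangle=a^*b$; for $h\in M(E)$, $a\in A$, $\xi\in E$ write $h\cdot a=h(a)\in E$, $\langle h,\xi\rangle=h^*(\xi)\in A$ and $\langle\xi,h\rangle=\langle h,\xi\rangle^*$. Assume that $E$ is countably generated in $M(E)$, i.e. there is a countable set $\{g_n\}_n\subseteq M(E)$ such that the closed submodule generated by $\{g_n\cdot a : a\in A,\ n\ge 1\}$ is the whole of $E$. A sequence $\{h_n\}_n$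 in $M(E)$ is a standard frame of multipliers in $E$ if $\sum_n\langle\xi,h_n\rangle\langle h_n,\xi\rangle$ converges in $A$ for every $\xi\in E$ and there are constants $C,D>0$ with $C\langle\xi,\xi\rangle\le\sum_n\langle\xi,h_n\rangle\langle h_n,\xi\rangle\le D\langle\xi,\xi\rangle$ for all $\xi\in E$. Its frame transform is the map $\theta:E\to H_A$, $\theta(\xi)=(\langle h_n,\xi\rangle)_n$, where $H_A$ is the set of sequences $(a_n)_n$ in $A$ for which $\sum_n a_n^*a_n$ converges in $A$, with $(a_n)_n b=(a_nb)_n$ and $\langle(a_n)_n,(b_n)_n\rangle=\sum_n a_n^*b_n$. A standard frame of multipliers $\{t_n\}_n$ in $E$ is a dual frame of $\{h_n\}_n$ if, for every $\xi\in E$, the series $\sum_n h_n\cdot\langle t_n,\xi\rangle$ converges in $E$ to $\xi$; two standard frames of multipliers are duals of each other if each of them is a dual frame of the other. **Proposition 4.6.** Let $\{h_n\}_n$ and $\{t_n\}_n$ be two standard frames of multipliers in $E$ with frame transforms $\theta_1$ and $\theta_2$. Then $\theta_1$ and $\theta_2$ are adjointable module morphisms $E\to H_A$, and $\{h_n\}_n$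 and $\{t_n\}_n$ are duals of each other if and only if $\theta_1^*\circ\theta_2=\mathrm{id}_E$. -/

import Mathlib

open Filter Topology
open scoped RightActions

universe u v w

/-! ### Facts on C⋆-seminorms

They are used only to see that `H_A` is a vector space. -/

/-- The completion of a unital algebra with a C⋆-norm is a C⋆-algebra. -/
theorem exists_cstar_completion {U : Type u} [NormedRing U] [StarRing U] [CStarRing U]
    [NormedAlgebra ℂ U] [StarModule ℂ U] :
    ∃ (B : Type u) (_ : CStarAlgebra B) (φ : U →⋆ₙₐ[ℂ] B), ∀ a, ‖φ a‖ = ‖a‖ := by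
  let B := UniformSpace.Completion U
  have cs : UniformContinuous (star : U → U) := (starₗᵢ ℂ).isometry.uniformContinuous
  let k0 : Star B := ⟨UniformSpace.Completion.map star⟩
  have kmk : ∀ u : U, star (u : B) = ((star u : U) : B) :=
    fun u => UniformSpace.Completion.map_coe cs u
  have kc : Continuous (star : B → B) := UniformSpace.Completion.continuous_map
  let k1 : StarRing B :=
    { star_involutive := fun x => by
        induction x using UniformSpace.Completion.induction_on with
        | hp => exact isClosed_eq (kc.comp kc) continuous_id
        | ih a => rw [kmk, kmk, star_star]
      star_mul := fun x y => by
        induction x, y using UniformSpace.Completion.induction_on₂ with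
        | hp => exact isClosed_eq (kc.comp (continuous_fst.mul continuous_snd))
                  ((kc.comp continuous_snd).mul (kc.comp continuous_fst))
        | ih a b => rw [← UniformSpace.Completion.coe_mul, kmk, kmk, kmk, star_mul,
                      UniformSpace.Completion.coe_mul]
      star_add := fun x y => by
        induction x, y using UniformSpace.Completion.induction_on₂ with
        | hp => exact isClosed_eq (kc.comp (continuous_fst.add continuous_snd))
                  ((kc.comp continuous_fst).add (kc.comp continuous_snd))
        | ih a b => rw [← UniformSpace.Completion.coe_add, kmk, kmk, kmk, star_add,
                      UniformSpace.Completion.coe_add] }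
  have k2 : CStarRing B := ⟨fun x => by
    induction x using UniformSpace.Completion.induction_on with
    | hp => exact isClosed_le (continuous_norm.mul continuous_norm) (kc.mul continuous_id).norm
    | ih a => rw [kmk, ← UniformSpace.Completion.coe_mul, UniformSpace.Completion.norm_coe,
                UniformSpace.Completion.norm_coe, CStarRing.norm_star_mul_self]⟩
  have k3 : StarModule ℂ B := ⟨fun c x => by
    induction x using UniformSpace.Completion.induction_on with
    | hp => exact isClosed_eq (kc.comp (continuous_id.const_smul c)) (kc.const_smul (star c))
    | ih a => rw [← UniformSpace.Completion.coe_smul, kmk, kmk, star_smul,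
                UniformSpace.Completion.coe_smul]⟩
  let kA : NormedAlgebra ℂ B :=
    { Algebra.ofModule
        (fun c x y => by
          induction x, y using UniformSpace.Completion.induction_on₂ with
          | hp => exact isClosed_eq ((continuous_fst.const_smul c).mul continuous_snd)
                    ((continuous_fst.mul continuous_snd).const_smul c)
          | ih a b => rw [← UniformSpace.Completion.coe_smul, ← UniformSpace.Completion.coe_mul,
                        ← UniformSpace.Completion.coe_mul, ← UniformSpace.Completion.coe_smul,
                        smul_mul_assoc])
        (fun c x y => by
          induction x, y using UniformSpace.Completion.induction_on₂ with
          | hp => exact isClosed_eq (continuous_fst.mul (continuous_snd.const_smul c))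
                    ((continuous_fst.mul continuous_snd).const_smul c)
          | ih a b => rw [← UniformSpace.Completion.coe_smul, ← UniformSpace.Completion.coe_mul,
                        ← UniformSpace.Completion.coe_mul, ← UniformSpace.Completion.coe_smul,
                        mul_smul_comm]) with
      norm_smul_le := norm_smul_le }
  let k4 : CStarAlgebra B :=
    { (inferInstance : NormedRing B), k1, kA with
      complete := CompleteSpace.complete
      norm_mul_self_le := k2.norm_mul_self_le
      star_smul := k3.star_smul }
  exact ⟨B, k4,
    { toFun := fun a => (a : B)
      map_smul' := fun c a => UniformSpace.Completion.coe_smul c a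
      map_zero' := rfl
      map_add' := fun a b => UniformSpace.Completion.coe_add a b
      map_mul' := fun a b => UniformSpace.Completion.coe_mul a b
      map_star' := fun a => (kmk a).symm }, fun a => UniformSpace.Completion.norm_coe a⟩

/-- A C⋆-seminorm is the pullback of the norm of a C⋆-algebra. -/
theorem exists_cstar_repr {A : Type u} [NonUnitalRing A] [StarRing A] [Module ℂ A]
    [IsScalarTower ℂ A A] [SMulCommClass ℂ A A] [StarModule ℂ A] (p : Seminorm ℂ A)
    (hmul : ∀ a b, p (a * b) ≤ p a * p b) (hstar : ∀ a, p (star a * a) = p a ^ 2) :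
    ∃ (B : Type u) (_ : CStarAlgebra B) (φ : A →⋆ₙₐ[ℂ] B), ∀ a, ‖φ a‖ = p a := by
  have hle : ∀ a, p (star a) = p a := by
    have key : ∀ a, p a ≤ p (star a) := by
      intro a
      have h1 := hmul (star a) a
      rw [hstar] at h1
      rcases (apply_nonneg p a).eq_or_lt with h0 | h0
      · rw [← h0]; exact apply_nonneg p _
      · exact le_of_mul_le_mul_right (by rwa [sq] at h1) h0
    intro a
    exact le_antisymm (by simpa using key (star a)) (key a)
  let i1 : SeminormedAddCommGroup A := p.toAddGroupSeminorm.toSeminormedAddCommGroup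
  have hnorm : ∀ a : A, ‖a‖ = p a := fun a => rfl
  let i2 : NonUnitalSeminormedRing A :=
    { (inferInstance : NonUnitalRing A), i1 with norm_mul_le := hmul }
  let i3 : NormedSpace ℂ A := { norm_smul_le := fun c a => (map_smul_eq_mul p c a).le }
  have i4 : NormedStarGroup A := ⟨fun a => (hle a).le⟩
  let Q := SeparationQuotient A
  let j0 : Star Q := ⟨SeparationQuotient.lift (fun a => SeparationQuotient.mk (star a))
    (fun a b h => by
      rw [SeparationQuotient.mk_eq_mk]
      exact h.map continuous_star)⟩
  have smk : ∀ a : A, star (SeparationQuotient.mk a : Q) = SeparationQuotient.mk (star a) :=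
    fun a => rfl
  let j1 : StarRing Q :=
    { star_involutive := fun x => by
        obtain ⟨a, rfl⟩ := SeparationQuotient.surjective_mk x
        simp [smk]
      star_mul := fun x y => by
        obtain ⟨a, rfl⟩ := SeparationQuotient.surjective_mk x
        obtain ⟨b, rfl⟩ := SeparationQuotient.surjective_mk y
        rw [← SeparationQuotient.mk_mul, smk, smk, smk, star_mul, SeparationQuotient.mk_mul]
      star_add := fun x y => by
        obtain ⟨a, rfl⟩ := SeparationQuotient.surjective_mk x
        obtain ⟨b, rfl⟩ := SeparationQuotient.surjective_mk y
        rw [← SeparationQuotient.mk_add, smk, smk, smk, star_add, SeparationQuotient.mk_add] }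
  have j2 : CStarRing Q := ⟨fun x => by
    obtain ⟨a, rfl⟩ := SeparationQuotient.surjective_mk x
    rw [smk, ← SeparationQuotient.mk_mul, SeparationQuotient.norm_mk, SeparationQuotient.norm_mk,
      hnorm, hnorm, hstar, sq]⟩
  have j3 : IsScalarTower ℂ Q Q := ⟨fun c x y => by
    obtain ⟨a, rfl⟩ := SeparationQuotient.surjective_mk x
    obtain ⟨b, rfl⟩ := SeparationQuotient.surjective_mk y
    simp only [smul_eq_mul]
    rw [← SeparationQuotient.mk_smul, ← SeparationQuotient.mk_mul, ← SeparationQuotient.mk_mul,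
      ← SeparationQuotient.mk_smul, smul_mul_assoc]⟩
  have j4 : SMulCommClass ℂ Q Q := ⟨fun c x y => by
    obtain ⟨a, rfl⟩ := SeparationQuotient.surjective_mk x
    obtain ⟨b, rfl⟩ := SeparationQuotient.surjective_mk y
    simp only [smul_eq_mul]
    rw [← SeparationQuotient.mk_smul, ← SeparationQuotient.mk_mul, ← SeparationQuotient.mk_mul,
      ← SeparationQuotient.mk_smul, mul_smul_comm]⟩
  have j5 : StarModule ℂ Q := ⟨fun c x => by
    obtain ⟨a, rfl⟩ := SeparationQuotient.surjective_mk x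
    rw [← SeparationQuotient.mk_smul, smk, smk, star_smul, SeparationQuotient.mk_smul]⟩
  obtain ⟨B, hB, φ, hφ⟩ := exists_cstar_completion (U := Unitization ℂ Q)
  refine ⟨B, hB,
    { toFun := fun a => φ ((SeparationQuotient.mk a : Q) : Unitization ℂ Q)
      map_smul' := fun c a => ?_
      map_zero' := ?_
      map_add' := fun a b => ?_
      map_mul' := fun a b => ?_
      map_star' := fun a => ?_ }, fun a => ?_⟩
  · simp only [SeparationQuotient.mk_smul, Unitization.inr_smul, MonoidHom.id_apply, map_smul]
  · simp only [SeparationQuotient.mk_zero, Unitization.inr_zero, map_zero]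
  · simp only [SeparationQuotient.mk_add, Unitization.inr_add, map_add]
  · simp only [SeparationQuotient.mk_mul, Unitization.inr_mul, map_mul]
  · rw [← smk, Unitization.inr_star, map_star]
  · change ‖φ ((SeparationQuotient.mk a : Q) : Unitization ℂ Q)‖ = p a
    rw [hφ, Unitization.norm_inr, SeparationQuotient.norm_mk, hnorm]

/-- C⋆-seminorms are monotone on sums of elements `a⋆ a`. -/
theorem seminorm_sum_le {A : Type u} {ι κ : Type*} [NonUnitalRing A] [StarRing A] [Module ℂ A]
    [IsScalarTower ℂ A A] [SMulCommClass ℂ A A] [StarModule ℂ A] (p : Seminorm ℂ A)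
    (hmul : ∀ a b, p (a * b) ≤ p a * p b) (hstar : ∀ a, p (star a * a) = p a ^ 2)
    (s : Finset ι) (t : Finset κ) (a : ι → A) (b : κ → A) :
    p (∑ i ∈ s, star (a i) * a i) ≤ p (∑ i ∈ s, star (a i) * a i + ∑ i ∈ t, star (b i) * b i) := by
  obtain ⟨B, _, φ, hφ⟩ := exists_cstar_repr p hmul hstar
  let := CStarAlgebra.spectralOrder B
  have := CStarAlgebra.spectralOrderedRing B
  rw [← hφ, ← hφ, map_add, map_sum, map_sum]
  simp only [map_mul, map_star]
  apply CStarAlgebra.norm_le_norm_of_nonneg_of_le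
  · exact Finset.sum_nonneg fun i _ => star_mul_self_nonneg _
  · exact le_add_of_nonneg_right (Finset.sum_nonneg fun i _ => star_mul_self_nonneg _)

/-! ### Pro-C⋆-algebras -/

/-- A C⋆-seminorm on a complex `*`-algebra `A`, continuous for the topology of `A`.  The type
`ContCStarSeminorm A` is the set `S(A)`. -/
structure ContCStarSeminorm (A : Type u) [NonUnitalRing A] [StarRing A] [Module ℂ A]
    [TopologicalSpace A] extends Seminorm ℂ A where
  mul_le : ∀ a b, toFun (a * b) ≤ toFun a * toFun b
  star_mul_self : ∀ a, toFun (star a * a) = toFun a ^ 2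
  cont : Continuous toFun

/-- A (not necessarily unital) pro-C⋆-algebra: a complete Hausdorff topological `*`-algebra over
`ℂ` whose topology is the one given by the family of all its continuous C⋆-seminorms. -/
class IsProCStarAlgebra (A : Type u) [NonUnitalRing A] [StarRing A] [Module ℂ A]
    [UniformSpace A] : Prop extends IsScalarTower ℂ A A, SMulCommClass ℂ A A, StarModule ℂ A,
    IsUniformAddGroup A, ContinuousMul A, ContinuousStar A, CompleteSpace A, T2Space A where
  withSeminorms : WithSeminorms (fun p : ContCStarSeminorm A => p.toSeminorm)

/-- Positive elements of a pro-C⋆-algebra. -/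
def IsPositiveElem {A : Type u} [NonUnitalRing A] [StarRing A] (a : A) : Prop :=
  ∃ b, a = star b * b

/-- The order of a pro-C⋆-algebra: `a ≤ b` when `b - a` is positive. -/
def ProLE {A : Type u} [NonUnitalRing A] [StarRing A] (a b : A) : Prop :=
  IsPositiveElem (b - a)

/-! ### Hilbert modules

The right action of `a : A` on `ξ` is `ξ <• a`, that is `MulOpposite.op a • ξ`. -/

/-- `E` is a Hilbert `A`-module: a complex vector space with a compatible right `A`-module
structure and an `A`-valued inner product, linear in the second variable, which is complete for
the topology given by the seminorms `ξ ↦ √(p ⟪ξ, ξ⟫)`, `p ∈ S(A)`. -/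
class IsHilbertModule (A : Type u) (E : Type v) [NonUnitalRing A] [StarRing A] [Module ℂ A]
    [UniformSpace A] [AddCommGroup E] [Module ℂ E] [SMul Aᵐᵒᵖ E] [Inner A E]
    [UniformSpace E] : Prop extends IsUniformAddGroup E, CompleteSpace E where
  act_add : ∀ (ξ : E) (a b : A), ξ <• (a + b) = ξ <• a + ξ <• b
  add_act : ∀ (ξ η : E) (a : A), (ξ + η) <• a = ξ <• a + η <• a
  act_mul : ∀ (ξ : E) (a b : A), ξ <• (a * b) = (ξ <• a) <• b
  smul_act : ∀ (c : ℂ) (ξ : E) (a : A), (c • ξ) <• a = c • (ξ <• a)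
  act_smul : ∀ (c : ℂ) (ξ : E) (a : A), ξ <• (c • a) = c • (ξ <• a)
  inner_add_right : ∀ ξ η ζ : E, inner A ξ (η + ζ) = inner A ξ η + inner A ξ ζ
  inner_smul_right : ∀ (ξ η : E) (c : ℂ), inner A ξ (c • η) = c • inner A ξ η
  inner_act_right : ∀ (ξ η : E) (a : A), inner A ξ (η <• a) = inner A ξ η * a
  star_inner : ∀ ξ η : E, star (inner A ξ η) = inner A η ξ
  inner_self_pos : ∀ ξ : E, IsPositiveElem (inner A ξ ξ)
  inner_self_eq_zero : ∀ ξ : E, inner A ξ ξ = 0 ↔ ξ = 0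
  nhds_zero : 𝓝 (0 : E) =
    ⨅ p : ContCStarSeminorm A, comap (fun ξ : E => √(p.toSeminorm (inner A ξ ξ))) (𝓝 0)

/-- `⟪a, b⟫ = a⋆ b` on `A`. The right action of `A` on itself is the right multiplication. -/
instance selfInner (A : Type u) [NonUnitalRing A] [StarRing A] : Inner A A :=
  ⟨fun a b => star a * b⟩

/-- `L(E, F)`: the adjointable module morphisms from `E` to `F`, with their adjoints. -/
structure AdjointableMap (A : Type u) (E : Type v) (F : Type w) [AddCommGroup E] [Module ℂ E]
    [SMul Aᵐᵒᵖ E] [Inner A E] [AddCommGroup F] [Module ℂ F] [SMul Aᵐᵒᵖ F] [Inner A F] where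
  toMap : E →ₗ[ℂ] F
  map_act : ∀ (ξ : E) (a : A), toMap (ξ <• a) = toMap ξ <• a
  adj : F →ₗ[ℂ] E
  adj_act : ∀ (η : F) (a : A), adj (η <• a) = adj η <• a
  inner_map : ∀ (ξ : E) (η : F), inner A (toMap ξ) η = inner A ξ (adj η)

/-- The adjoint is determined by the map. -/
theorem AdjointableMap.adj_unique {A : Type u} {E : Type v} {F : Type w} [NonUnitalRing A]
    [StarRing A] [Module ℂ A] [UniformSpace A] [AddCommGroup E] [Module ℂ E] [SMul Aᵐᵒᵖ E]
    [Inner A E] [UniformSpace E] [IsHilbertModule A E] [AddCommGroup F] [Module ℂ F]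
    [SMul Aᵐᵒᵖ F] [Inner A F] (S T : AdjointableMap A E F) (h : S.toMap = T.toMap) :
    S.adj = T.adj := by
  ext η
  have key : ∀ ξ : E, inner A ξ (S.adj η) = inner A ξ (T.adj η) := fun ξ => by
    rw [← S.inner_map, ← T.inner_map, h]
  have h1 := IsHilbertModule.inner_add_right (A := A) (S.adj η - T.adj η)
    (S.adj η - T.adj η) (T.adj η)
  rw [sub_add_cancel, key, eq_comm, add_eq_right] at h1
  exact sub_eq_zero.mp ((IsHilbertModule.inner_self_eq_zero _).mp h1)

/-- The multiplier module `M(E) = L(A, E)`. For `h ∈ M(E)`, `a ∈ A` and `ξ ∈ E`, the element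
`h · a` of `E` is `h.toMap a`, and `⟪h, ξ⟫ = h⋆(ξ)` is `h.adj ξ`, an element of `A`. -/
abbrev Multiplier (A : Type u) (E : Type v) [NonUnitalRing A] [StarRing A] [Module ℂ A]
    [AddCommGroup E] [Module ℂ E] [SMul Aᵐᵒᵖ E] [Inner A E] :=
  AdjointableMap A A E

/-- `E` is countably generated in `M(E)`: for some sequence `g n` in `M(E)`, the closed submodule
generated by the elements `g n · a` is the whole of `E`. (These elements lie in `E`, they are
stable under the action of `A`, and `E` is closed in `M(E)` and carries the induced topology, so
this is the closure in `E` of their linear span.) -/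
def CountablyGeneratedInMultipliers (A : Type u) (E : Type v) [NonUnitalRing A] [StarRing A]
    [Module ℂ A] [AddCommGroup E] [Module ℂ E] [SMul Aᵐᵒᵖ E] [Inner A E]
    [UniformSpace E] : Prop :=
  ∃ g : ℕ → Multiplier A E,
    closure (Submodule.span ℂ {ξ : E | ∃ n a, (g n).toMap a = ξ} : Set E) = Set.univ

/-! ### The standard Hilbert module -/

section StandardModule

variable {A : Type u} [NonUnitalRing A] [StarRing A] [Module ℂ A] [UniformSpace A]
  [IsProCStarAlgebra A]

theorem cauchySeq_iff_contCStarSeminorm (u : ℕ → A) :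
    CauchySeq u ↔ ∀ (p : ContCStarSeminorm A) (ε : ℝ), 0 < ε →
      ∀ᶠ x : ℕ × ℕ in atTop, p.toSeminorm (u x.2 - u x.1) < ε := by
  rw [cauchySeq_iff_tendsto, uniformity_eq_comap_nhds_zero, tendsto_comap_iff,
    (IsProCStarAlgebra.withSeminorms (A := A)).tendsto_nhds]
  simp

theorem exists_tendsto_add_sq {x y : ℕ → A}
    (hx : ∃ s, Tendsto (fun N => ∑ n ∈ Finset.range N, star (x n) * x n) atTop (𝓝 s))
    (hy : ∃ s, Tendsto (fun N => ∑ n ∈ Finset.range N, star (y n) * y n) atTop (𝓝 s)) :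
    ∃ s, Tendsto (fun N => ∑ n ∈ Finset.range N, star ((x + y) n) * (x + y) n) atTop (𝓝 s) := by
  obtain ⟨s, hs⟩ := hx
  obtain ⟨t, ht⟩ := hy
  apply cauchySeq_tendsto_of_complete
  have h1 := (cauchySeq_iff_contCStarSeminorm _).mp hs.cauchySeq
  have h2 := (cauchySeq_iff_contCStarSeminorm _).mp ht.cauchySeq
  rw [cauchySeq_iff_contCStarSeminorm]
  intro p ε hε
  have key : ∀ m n : ℕ, m ≤ n →
      p.toSeminorm (∑ k ∈ Finset.range n, star ((x + y) k) * (x + y) k -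
        ∑ k ∈ Finset.range m, star ((x + y) k) * (x + y) k) ≤
      2 * p.toSeminorm (∑ k ∈ Finset.range n, star (x k) * x k -
        ∑ k ∈ Finset.range m, star (x k) * x k) +
      2 * p.toSeminorm (∑ k ∈ Finset.range n, star (y k) * y k -
        ∑ k ∈ Finset.range m, star (y k) * y k) := by
    intro m n hmn
    rw [← Finset.sum_Ico_eq_sub _ hmn, ← Finset.sum_Ico_eq_sub _ hmn,
      ← Finset.sum_Ico_eq_sub _ hmn]
    refine (seminorm_sum_le p.toSeminorm p.mul_le p.star_mul_self (Finset.Ico m n)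
      (Finset.Ico m n) (x + y) (x - y)).trans ?_
    have e : ∑ i ∈ Finset.Ico m n, star ((x + y) i) * (x + y) i +
        ∑ i ∈ Finset.Ico m n, star ((x - y) i) * (x - y) i =
        (2 : ℂ) • ∑ k ∈ Finset.Ico m n, star (x k) * x k +
        (2 : ℂ) • ∑ k ∈ Finset.Ico m n, star (y k) * y k := by
      simp only [Finset.smul_sum, ← Finset.sum_add_distrib]
      refine Finset.sum_congr rfl fun k _ => ?_
      simp only [Pi.add_apply, Pi.sub_apply, star_add, star_sub, add_mul, mul_add, sub_mul,
        mul_sub]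
      module
    rw [e]
    refine (map_add_le_add _ _ _).trans ?_
    rw [map_smul_eq_mul, map_smul_eq_mul]
    simp
  filter_upwards [h1 p (ε / 4) (by positivity), h2 p (ε / 4) (by positivity)] with z hz1 hz2
  rcases le_total z.1 z.2 with hle | hle
  · linarith [key _ _ hle]
  · have := key _ _ hle
    rw [map_sub_rev, map_sub_rev p.toSeminorm (∑ k ∈ Finset.range z.1, star (x k) * x k),
      map_sub_rev p.toSeminorm (∑ k ∈ Finset.range z.1, star (y k) * y k)] at this
    linarith

theorem exists_tendsto_smul_sq {x : ℕ → A} (c : ℂ)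
    (hx : ∃ s, Tendsto (fun N => ∑ n ∈ Finset.range N, star (x n) * x n) atTop (𝓝 s)) :
    ∃ s, Tendsto (fun N => ∑ n ∈ Finset.range N, star ((c • x) n) * (c • x) n) atTop (𝓝 s) := by
  obtain ⟨s, hs⟩ := hx
  have hc : Continuous fun a : A => (star c * c) • a :=
    (IsProCStarAlgebra.withSeminorms (A := A)).continuousSMul.continuous_smul.comp
      (continuous_const.prodMk continuous_id)
  refine ⟨_, ((hc.tendsto s).comp hs).congr fun N => ?_⟩
  simp [Finset.smul_sum, smul_mul_smul_comm]

/-- The underlying complex vector space of the standard Hilbert module `H_A`: the sequences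
`(a_n)` in `A` such that `∑ a_n⋆ a_n` converges in `A`. -/
def stdModule (A : Type u) [NonUnitalRing A] [StarRing A] [Module ℂ A] [UniformSpace A]
    [IsProCStarAlgebra A] : Submodule ℂ (ℕ → A) where
  carrier := {x | ∃ s, Tendsto (fun N => ∑ n ∈ Finset.range N, star (x n) * x n) atTop (𝓝 s)}
  add_mem' := exists_tendsto_add_sq
  zero_mem' := ⟨0, by simp⟩
  smul_mem' := fun c _ => exists_tendsto_smul_sq c

/-- `(a_n) b = (a_n b)`. -/
instance stdModuleAct : SMul Aᵐᵒᵖ (stdModule A) :=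
  ⟨fun b x => ⟨fun n => x.1 n * b.unop, by
    obtain ⟨s, hs⟩ := x.2
    refine ⟨star b.unop * s * b.unop, ?_⟩
    refine ((hs.const_mul (star b.unop)).mul_const b.unop).congr fun N => ?_
    simp [Finset.mul_sum, Finset.sum_mul, mul_assoc]⟩⟩

/-- `⟪(a_n), (b_n)⟫ = ∑ a_n⋆ b_n`. -/
noncomputable instance stdModuleInner : Inner A (stdModule A) :=
  ⟨fun x y => limUnder atTop (fun N => ∑ n ∈ Finset.range N, star (x.1 n) * y.1 n)⟩

/-- The series defining the inner product of `H_A` converges. -/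
theorem stdModule_inner_tendsto (x y : stdModule A) :
    Tendsto (fun N => ∑ n ∈ Finset.range N, star (x.1 n) * y.1 n) atTop (𝓝 (inner A x y)) := by
  refine tendsto_nhds_limUnder ?_
  obtain ⟨s1, h1⟩ := (x + y).2
  obtain ⟨s2, h2⟩ := (x - y).2
  obtain ⟨s3, h3⟩ := (x + Complex.I • y).2
  obtain ⟨s4, h4⟩ := (x - Complex.I • y).2
  have hc : ∀ c : ℂ, Continuous fun a : A => c • a := fun c =>
    (IsProCStarAlgebra.withSeminorms (A := A)).continuousSMul.continuous_smul.comp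
      (continuous_const.prodMk continuous_id)
  have := (((((hc 4⁻¹).tendsto _).comp h1).sub (((hc 4⁻¹).tendsto _).comp h2)).sub
    (((hc (4⁻¹ * Complex.I)).tendsto _).comp h3)).add
    (((hc (4⁻¹ * Complex.I)).tendsto _).comp h4)
  refine ⟨_, this.congr fun N => ?_⟩
  simp only [Function.comp_apply, Finset.smul_sum, ← Finset.sum_add_distrib,
    ← Finset.sum_sub_distrib]
  refine Finset.sum_congr rfl fun n _ => ?_
  simp only [Submodule.coe_add, Submodule.coe_sub, Submodule.coe_smul, Pi.add_apply,
    Pi.sub_apply, Pi.smul_apply, star_add, star_sub, star_smul, add_mul, mul_add, sub_mul,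
    mul_sub, smul_mul_assoc, mul_smul_comm, Complex.star_def, Complex.conj_I]
  match_scalars <;> ring_nf <;> simp <;> norm_num

end StandardModule

/-! ### Frames of multipliers -/

section Frames

variable {A : Type u} {E : Type v} [NonUnitalRing A] [StarRing A] [Module ℂ A] [UniformSpace A]
  [AddCommGroup E] [Module ℂ E] [SMul Aᵐᵒᵖ E] [Inner A E]

/-- `{h n}` is a standard frame of multipliers in `E`: for each `ξ` the series
`∑ ⟪ξ, h n⟫ ⟪h n, ξ⟫` converges in `A`, and for some constants `C, D > 0` its sum `s` satisfies
`C ⟪ξ, ξ⟫ ≤ s ≤ D ⟪ξ, ξ⟫` for all `ξ`. Here `⟪h n, ξ⟫ = (h n)⋆ ξ` and `⟪ξ, h n⟫ = ⟪h n, ξ⟫⋆`. -/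
def IsStandardFrame (h : ℕ → Multiplier A E) : Prop :=
  ∃ C D : ℝ, 0 < C ∧ 0 < D ∧ ∀ ξ : E, ∃ s : A,
    Tendsto (fun N => ∑ n ∈ Finset.range N, star ((h n).adj ξ) * (h n).adj ξ) atTop (𝓝 s) ∧
    ProLE ((C : ℂ) • inner A ξ ξ) s ∧ ProLE s ((D : ℂ) • inner A ξ ξ)

/-- `t` is a dual frame of multipliers of `h`: both are standard frames of multipliers and, for
every `ξ`, the series `∑ h n · ⟪t n, ξ⟫` converges to `ξ` in `E`. -/
def IsDualFrame [UniformSpace E] (h t : ℕ → Multiplier A E) : Prop :=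
  IsStandardFrame h ∧ IsStandardFrame t ∧
    ∀ ξ : E, Tendsto (fun N => ∑ n ∈ Finset.range N, (h n).toMap ((t n).adj ξ)) atTop (𝓝 ξ)

/-- The frame transform `θ : E → H_A`, `θ ξ = (⟪h n, ξ⟫)_n`, of a standard frame. -/
def frameTransform [IsProCStarAlgebra A] (h : ℕ → Multiplier A E) (hh : IsStandardFrame h) :
    E →ₗ[ℂ] stdModule A :=
  LinearMap.codRestrict (stdModule A) (LinearMap.pi fun n => (h n).adj) fun ξ => by
    obtain ⟨_, _, _, _, H⟩ := hh
    obtain ⟨s, hs, _⟩ := H ξ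
    exact ⟨s, hs⟩

end Frames

/-! ### C⋆-seminorms and positive elements. -/

section ProCStar

variable {A : Type u} [NonUnitalRing A] [StarRing A] [Module ℂ A] [UniformSpace A]

/-! The adjoint of a frame transform is synthesis, `(a n) ↦ ∑ h n · a n`. Hence `θ₁⋆ (θ₂ ξ)` is the
reconstruction series `∑ h n · ⟪t n, ξ⟫`, and `θ₁⋆ θ₂ = id` says that `t` is a dual frame of `h`.
Taking adjoints gives `θ₂⋆ θ₁ = id`, so the relation is symmetric.

The work lies in the convergence of synthesis on all of `H_A`.
`IsStandardFrame.exists_seminorm_sum_le` bounds finite blocks of the series by the upper frame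
bound, and completeness of `E` does the rest. Estimates come from algebraic identities: a sum of
squares is added to a positive element, and C⋆-seminorms are monotone under this.
`IsHilbertModule.seminorm_inner_sq_le`, a weak Cauchy–Schwarz inequality, makes the inner product
continuous, so that it passes through the series. As adjoints are unique, the choice of `θ₁` and
`θ₂` is immaterial. -/

theorem ContCStarSeminorm.apply_star_mul_self (p : ContCStarSeminorm A) (a : A) :
    p.toSeminorm (star a * a) = p.toSeminorm a ^ 2 :=
  p.star_mul_self a

theorem ContCStarSeminorm.apply_mul_le (p : ContCStarSeminorm A) (a b : A) :
    p.toSeminorm (a * b) ≤ p.toSeminorm a * p.toSeminorm b :=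
  p.mul_le a b

theorem ContCStarSeminorm.apply_star (p : ContCStarSeminorm A) (a : A) :
    p.toSeminorm (star a) = p.toSeminorm a := by
  have key : ∀ a, p.toSeminorm a ≤ p.toSeminorm (star a) := fun a => by
    have h1 := p.apply_mul_le (star a) a
    rw [p.apply_star_mul_self] at h1
    rcases (apply_nonneg p.toSeminorm a).eq_or_lt with h0 | h0
    · rw [← h0]
      exact apply_nonneg _ _
    · exact le_of_mul_le_mul_right (by rwa [sq] at h1) h0
  exact le_antisymm (by simpa using key (star a)) (key a)

variable [IsProCStarAlgebra A]

theorem IsPositiveElem.real_smul {a : A} (ha : IsPositiveElem a) {r : ℝ} (hr : 0 ≤ r) :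
    IsPositiveElem ((r : ℂ) • a) := by
  obtain ⟨c, rfl⟩ := ha
  refine ⟨((√r : ℝ) : ℂ) • c, ?_⟩
  rw [star_smul, smul_mul_smul_comm, Complex.star_def, Complex.conj_ofReal, ← Complex.ofReal_mul,
    Real.mul_self_sqrt hr]

/-- C⋆-seminorms are monotone on positive elements. -/
theorem ContCStarSeminorm.le_add_sum (p : ContCStarSeminorm A) {a : A} (ha : IsPositiveElem a)
    {ι : Type*} (s : Finset ι) (d : ι → A) :
    p.toSeminorm a ≤ p.toSeminorm (a + ∑ i ∈ s, star (d i) * d i) := by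
  obtain ⟨c, rfl⟩ := ha
  simpa using seminorm_sum_le p.toSeminorm p.mul_le p.star_mul_self
    (Finset.univ : Finset Unit) s (fun _ => c) d

theorem ContCStarSeminorm.le_add (p : ContCStarSeminorm A) {a b : A} (ha : IsPositiveElem a)
    (hb : IsPositiveElem b) : p.toSeminorm a ≤ p.toSeminorm (a + b) := by
  obtain ⟨c, rfl⟩ := hb
  simpa using p.le_add_sum ha (Finset.univ : Finset Unit) fun _ => c

/-- If `∑ star (b n) * b n` converges to `s ≤ a`, the seminorms of its finite blocks are at most
that of `a`. -/
theorem ContCStarSeminorm.sum_le_of_tendsto (p : ContCStarSeminorm A) {b : ℕ → A} {s a : A}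
    (hs : Tendsto (fun N => ∑ n ∈ Finset.range N, star (b n) * b n) atTop (𝓝 s))
    (hsa : ProLE s a) (m n : ℕ) :
    p.toSeminorm (∑ k ∈ Finset.Ico m n, star (b k) * b k) ≤ p.toSeminorm a := by
  obtain ⟨c, hc⟩ := hsa
  have hp : Continuous p.toSeminorm := p.cont
  -- Since `star c * c = a - s`, the partial sums shifted by this constant converge to `a` itself.
  -- Closedness of the positive cone is therefore not needed.
  have hlim := (hp.tendsto _).comp (hs.add_const (star c * c))
  rw [← hc, add_sub_cancel] at hlim
  refine ge_of_tendsto hlim ?_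
  filter_upwards [eventually_ge_atTop n] with N hN
  have hsub : Finset.Ico m n ⊆ Finset.range N := fun k hk => by
    simp only [Finset.mem_Ico, Finset.mem_range] at hk ⊢
    omega
  refine (seminorm_sum_le p.toSeminorm p.mul_le p.star_mul_self (Finset.Ico m n)
    (Finset.range N \ Finset.Ico m n) b b).trans ?_
  rw [add_comm, Finset.sum_sdiff hsub]
  rw [hc]
  simpa using seminorm_sum_le p.toSeminorm p.mul_le p.star_mul_self (Finset.range N)
    (Finset.univ : Finset Unit) b fun _ => c

end ProCStar

/-! ### Hilbert modules: topology and continuity of the inner product. -/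

section HilbertModule

variable {A : Type u} {E : Type v} [NonUnitalRing A] [StarRing A] [Module ℂ A] [UniformSpace A]
  [AddCommGroup E] [Module ℂ E] [SMul Aᵐᵒᵖ E] [Inner A E] [UniformSpace E] [IsHilbertModule A E]

namespace IsHilbertModule

/-- `ξ ↦ ⟪ζ, ξ⟫` as a linear map. -/
def innerLin (ζ : E) : E →ₗ[ℂ] A where
  toFun ξ := inner A ζ ξ
  map_add' := inner_add_right ζ
  map_smul' c ξ := inner_smul_right ζ ξ c

theorem inner_sub_right (ζ ξ η : E) : inner A ζ (ξ - η) = inner A ζ ξ - inner A ζ η :=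
  map_sub (innerLin ζ) ξ η

theorem inner_sum_right {ι : Type*} (ζ : E) (s : Finset ι) (f : ι → E) :
    inner A ζ (∑ i ∈ s, f i) = ∑ i ∈ s, inner A ζ (f i) :=
  map_sum (innerLin ζ) f s

theorem inner_sub_left (ξ η ζ : E) : inner A (ξ - η) ζ = inner A ξ ζ - inner A η ζ := by
  rw [← star_inner, inner_sub_right, star_sub, star_inner, star_inner]

theorem inner_act_left (ξ η : E) (a : A) : inner A (ξ <• a) η = star a * inner A ξ η := by
  rw [← star_inner, inner_act_right, star_mul, star_inner]

theorem inner_sum_left {ι : Type*} (ζ : E) (s : Finset ι) (f : ι → E) :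
    inner A (∑ i ∈ s, f i) ζ = ∑ i ∈ s, inner A (f i) ζ := by
  rw [← star_inner, inner_sum_right, star_sum]
  simp only [star_inner]

variable (A) in
theorem ext_inner {ξ η : E} (h : ∀ ζ : E, inner A ζ ξ = inner A ζ η) : ξ = η := by
  refine sub_eq_zero.mp ((inner_self_eq_zero (A := A) _).mp ?_)
  rw [inner_sub_right, h, sub_self]

variable (A) in
theorem tendsto_zero_iff {ι : Type*} {l : Filter ι} {f : ι → E} :
    Tendsto f l (𝓝 0) ↔ ∀ p : ContCStarSeminorm A,
      Tendsto (fun i => p.toSeminorm (inner A (f i) (f i))) l (𝓝 0) := by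
  rw [nhds_zero (A := A), tendsto_iInf]
  refine forall_congr' fun p => ?_
  rw [tendsto_comap_iff]
  constructor
  · intro h
    have h2 := h.pow 2
    simpa [Function.comp_def, Real.sq_sqrt, apply_nonneg] using h2
  · intro h
    have h2 := (Real.continuous_sqrt.tendsto 0).comp h
    rwa [Real.sqrt_zero] at h2

theorem cauchySeq_of_seminorm {f : ℕ → E}
    (hf : ∀ p : ContCStarSeminorm A, Tendsto (fun x : ℕ × ℕ =>
      p.toSeminorm (inner A (f x.2 - f x.1) (f x.2 - f x.1))) atTop (𝓝 0)) : CauchySeq f := by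
  have : IsUniformAddGroup E := toIsUniformAddGroup A
  rw [cauchySeq_iff_tendsto, uniformity_eq_comap_nhds_zero, tendsto_comap_iff]
  exact (tendsto_zero_iff A).mpr hf

variable [IsProCStarAlgebra A]

/-- Expand the positive element `⟪ξ a - r η, ξ a - r η⟫` with `a = ⟪ξ, η⟫`. The cross terms are `-2
r a⋆ a`, so `2 r p(a)² ≤ r p(a)² + r² p(⟪η, η⟫)`. The `+ 1` keeps `r` positive, so that one may
divide by it; the sharp constant is irrelevant for continuity. -/
theorem seminorm_inner_sq_le (p : ContCStarSeminorm A) (ξ η : E) :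
    p.toSeminorm (inner A ξ η) ^ 2 ≤
      (p.toSeminorm (inner A ξ ξ) + 1) * p.toSeminorm (inner A η η) := by
  set a : A := inner A ξ η with ha
  set r : ℝ := p.toSeminorm (inner A ξ ξ) + 1 with hr
  have hr0 : 0 < r := by have := apply_nonneg p.toSeminorm (inner A ξ ξ); positivity
  have hη : inner A η ξ = star a := (star_inner ξ η).symm
  have key : ((2 * r : ℝ) : ℂ) • (star a * a) +
      inner A (ξ <• a - (r : ℂ) • η) (ξ <• a - (r : ℂ) • η) =
      star a * inner A ξ ξ * a + ((r ^ 2 : ℝ) : ℂ) • inner A η η := by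
    have hsl : ∀ ζ : E, inner A ((r : ℂ) • η) ζ = (r : ℂ) • inner A η ζ := fun ζ => by
      rw [← star_inner, inner_smul_right, star_smul, star_inner, Complex.star_def,
        Complex.conj_ofReal]
    simp only [inner_sub_right, inner_sub_left, inner_act_left, inner_act_right, inner_smul_right,
      hsl, hη, ← ha, mul_assoc, sub_mul, smul_mul_assoc, Complex.ofReal_mul, Complex.ofReal_pow,
      Complex.ofReal_ofNat]
    module
  have h1 := p.le_add (IsPositiveElem.real_smul ⟨a, rfl⟩ (by positivity : 0 ≤ 2 * r))
    (inner_self_pos (ξ <• a - (r : ℂ) • η))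
  rw [key] at h1
  have h2 := h1.trans (map_add_le_add p.toSeminorm _ _)
  rw [map_smul_eq_mul, map_smul_eq_mul, p.apply_star_mul_self, Complex.norm_real,
    Complex.norm_real, Real.norm_of_nonneg (by positivity), Real.norm_of_nonneg (by positivity)]
    at h2
  have h3 : p.toSeminorm (star a * inner A ξ ξ * a) ≤
      r * p.toSeminorm a ^ 2 := by
    calc p.toSeminorm (star a * inner A ξ ξ * a)
        ≤ p.toSeminorm (star a) * p.toSeminorm (inner A ξ ξ) * p.toSeminorm a :=
          (p.apply_mul_le _ _).trans
            (mul_le_mul_of_nonneg_right (p.apply_mul_le _ _) (apply_nonneg _ _))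
      _ = p.toSeminorm (inner A ξ ξ) * p.toSeminorm a ^ 2 := by rw [p.apply_star]; ring
      _ ≤ r * p.toSeminorm a ^ 2 :=
          mul_le_mul_of_nonneg_right (by linarith) (sq_nonneg _)
  refine le_of_mul_le_mul_left ?_ hr0
  nlinarith

/-- Besides moving inner products through series, this lets limits in `E` be compared in the
Hausdorff algebra `A`, after pairing with every `ζ`. -/
theorem tendsto_inner_right (ζ : E) {ι : Type*} {l : Filter ι} {f : ι → E} {ξ : E}
    (hf : Tendsto f l (𝓝 ξ)) : Tendsto (fun i => inner A ζ (f i)) l (𝓝 (inner A ζ ξ)) := by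
  have : IsUniformAddGroup E := toIsUniformAddGroup A
  have h0 : Tendsto (fun i => f i - ξ) l (𝓝 0) := by simpa using hf.sub_const ξ
  rw [tendsto_zero_iff A] at h0
  rw [(IsProCStarAlgebra.withSeminorms (A := A)).tendsto_nhds]
  intro p ε hε
  have hpos : 0 < p.toSeminorm (inner A ζ ζ) + 1 := by
    have := apply_nonneg p.toSeminorm (inner A ζ ζ)
    positivity
  filter_upwards [(h0 p).eventually_lt_const
    (div_pos (pow_pos hε 2) hpos)] with i hi
  rw [← inner_sub_right]
  refine lt_of_pow_lt_pow_left₀ 2 hε.le ((seminorm_inner_sq_le p ζ _).trans_lt ?_)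
  rwa [lt_div_iff₀' hpos] at hi

end IsHilbertModule

end HilbertModule

/-! ### Synthesis and the adjoint of the frame transform. -/

section FrameTransform

variable {A : Type u} {E : Type v} [NonUnitalRing A] [StarRing A] [Module ℂ A] [UniformSpace A]
  [AddCommGroup E] [Module ℂ E] [SMul Aᵐᵒᵖ E] [Inner A E] [UniformSpace E] [IsHilbertModule A E]

open IsHilbertModule

theorem Multiplier.inner_toMap_right (g : Multiplier A E) (a : A) (ξ : E) :
    inner A ξ (g.toMap a) = star (g.adj ξ) * a := by
  rw [← star_inner, g.inner_map]
  exact (star_mul _ _).trans (by rw [star_star])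

variable [IsProCStarAlgebra A]

/-- For `η = ∑ h k · a k`, complete the square in `∑ |D a k - ⟪h k, η⟫|²`: both cross sums equal
`⟪η, η⟫`, and the upper frame bound controls `∑ |⟪h k, η⟫|²` by `D ⟪η, η⟫`. -/
theorem IsStandardFrame.exists_seminorm_sum_le {h : ℕ → Multiplier A E} (hh : IsStandardFrame h) :
    ∃ D : ℝ, 0 < D ∧ ∀ (p : ContCStarSeminorm A) (a : ℕ → A) (m n : ℕ),
      p.toSeminorm (inner A (∑ k ∈ Finset.Ico m n, (h k).toMap (a k))
        (∑ k ∈ Finset.Ico m n, (h k).toMap (a k))) ≤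
      D * p.toSeminorm (∑ k ∈ Finset.Ico m n, star (a k) * a k) := by
  obtain ⟨C, D, -, hD, H⟩ := hh
  refine ⟨D, hD, fun p a m n => ?_⟩
  set η := ∑ k ∈ Finset.Ico m n, (h k).toMap (a k) with hη
  obtain ⟨s, hs, -, hsD⟩ := H η
  have hb := p.sum_le_of_tendsto hs hsD m n
  have e1 : inner A η η = ∑ k ∈ Finset.Ico m n, star (a k) * (h k).adj η := by
    conv_lhs => rw [hη, inner_sum_left]
    exact Finset.sum_congr rfl fun k _ => (h k).inner_map _ _
  have e2 : inner A η η = ∑ k ∈ Finset.Ico m n, star ((h k).adj η) * a k := by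
    conv_lhs => rw [hη, inner_sum_right]
    exact Finset.sum_congr rfl fun k _ => (h k).inner_toMap_right _ _
  have key : ((2 * D : ℝ) : ℂ) • inner A η η + ∑ k ∈ Finset.Ico m n,
        star ((D : ℂ) • a k - (h k).adj η) * ((D : ℂ) • a k - (h k).adj η) =
      ((D ^ 2 : ℝ) : ℂ) • ∑ k ∈ Finset.Ico m n, star (a k) * a k +
        ∑ k ∈ Finset.Ico m n, star ((h k).adj η) * (h k).adj η := by
    -- The two copies match the two cross terms of the square: `e1` expands one, `e2` the other.
    have e3 : ((2 * D : ℝ) : ℂ) • inner A η η =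
        (D : ℂ) • inner A η η + (D : ℂ) • inner A η η := by
      push_cast
      module
    rw [e3]
    nth_rewrite 1 [e1]
    rw [e2]
    simp only [Finset.smul_sum, ← Finset.sum_add_distrib]
    refine Finset.sum_congr rfl fun k _ => ?_
    simp only [star_sub, star_smul, sub_mul, mul_sub, smul_mul_assoc, mul_smul_comm,
      Complex.star_def, Complex.conj_ofReal, Complex.ofReal_pow]
    module
  have h1 := p.le_add_sum ((inner_self_pos (A := A) η).real_smul (by positivity : 0 ≤ 2 * D))
    (Finset.Ico m n) fun k => (D : ℂ) • a k - (h k).adj η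
  rw [key] at h1
  have h2 := h1.trans (map_add_le_add p.toSeminorm _ _)
  rw [map_smul_eq_mul, Complex.norm_real, Real.norm_of_nonneg hD.le] at hb
  rw [map_smul_eq_mul, map_smul_eq_mul, Complex.norm_real, Complex.norm_real,
    Real.norm_of_nonneg (by positivity), Real.norm_of_nonneg (by positivity)] at h2
  -- With `P = p ⟪η, η⟫` and `Q = p (∑ a k⋆ a k)`, `h2` and `hb` give `2 D P ≤ D² Q + D P`.
  refine le_of_mul_le_mul_left ?_ hD
  nlinarith

/-- The synthesis series `∑ h n · a n` converges for every `(a n)` in `H_A`. -/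
theorem IsStandardFrame.exists_tendsto_synthesis {h : ℕ → Multiplier A E}
    (hh : IsStandardFrame h) (x : stdModule A) :
    ∃ ξ : E, Tendsto (fun N => ∑ n ∈ Finset.range N, (h n).toMap (x.1 n)) atTop (𝓝 ξ) := by
  have : CompleteSpace E := toCompleteSpace A
  obtain ⟨D, hD, H⟩ := hh.exists_seminorm_sum_le
  obtain ⟨s, hs⟩ := x.2
  refine cauchySeq_tendsto_of_complete (cauchySeq_of_seminorm (A := A) fun p => ?_)
  have hp : Tendsto (fun z : ℕ × ℕ => p.toSeminorm (∑ n ∈ Finset.range z.2, star (x.1 n) * x.1 n -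
      ∑ n ∈ Finset.range z.1, star (x.1 n) * x.1 n)) atTop (𝓝 0) := by
    have := (cauchySeq_iff_contCStarSeminorm _).mp hs.cauchySeq p
    rw [Metric.tendsto_nhds]
    intro ε hε
    filter_upwards [this ε hε] with z hz
    rwa [Real.dist_0_eq_abs, abs_of_nonneg (apply_nonneg _ _)]
  have hD0 := hp.const_mul D
  rw [mul_zero] at hD0
  refine squeeze_zero (fun z => apply_nonneg _ _) (fun z => ?_) hD0
  rcases le_total z.1 z.2 with hle | hle
  · rw [← Finset.sum_Ico_eq_sub _ hle, ← Finset.sum_Ico_eq_sub _ hle]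
    exact H p _ _ _
  · have e : ∀ ξ η : E, inner A (ξ - η) (ξ - η) = inner A (η - ξ) (η - ξ) := fun ξ η => by
      simp only [IsHilbertModule.inner_sub_left, IsHilbertModule.inner_sub_right]
      abel
    rw [e, map_sub_rev, ← Finset.sum_Ico_eq_sub _ hle, ← Finset.sum_Ico_eq_sub _ hle]
    exact H p _ _ _

theorem inner_frameTransform_of_tendsto {h : ℕ → Multiplier A E} (hh : IsStandardFrame h)
    {x : stdModule A} {η : E}
    (hη : Tendsto (fun N => ∑ n ∈ Finset.range N, (h n).toMap (x.1 n)) atTop (𝓝 η)) (ξ : E) :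
    inner A (frameTransform h hh ξ) x = inner A ξ η := by
  refine tendsto_nhds_unique (stdModule_inner_tendsto _ _)
    ((tendsto_inner_right ξ hη).congr fun N => ?_)
  rw [inner_sum_right]
  exact Finset.sum_congr rfl fun n _ => (h n).inner_toMap_right _ _

/-- The frame transform of a standard frame of multipliers as an adjointable map. Its adjoint is
the synthesis map `(a n) ↦ ∑ h n · a n`. -/
theorem IsStandardFrame.exists_adjointable_frameTransform {h : ℕ → Multiplier A E}
    (hh : IsStandardFrame h) :
    ∃ θ : AdjointableMap A E (stdModule A), θ.toMap = frameTransform h hh ∧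
      ∀ x : stdModule A,
        Tendsto (fun N => ∑ n ∈ Finset.range N, (h n).toMap (x.1 n)) atTop (𝓝 (θ.adj x)) := by
  choose S hS using hh.exists_tendsto_synthesis
  -- This adjoint relation also forces `S` to be linear and `A`-linear, because elements of `E` are
  -- determined by their inner products.
  have hI : ∀ x ξ, inner A (frameTransform h hh ξ) x = inner A ξ (S x) :=
    fun x => inner_frameTransform_of_tendsto hh (hS x)
  refine ⟨{ toMap := frameTransform h hh
            map_act := fun ξ a => Subtype.ext (funext fun n => (h n).adj_act ξ a)
            adj := { toFun := S
                     map_add' := fun x y => ext_inner A fun ζ => ?_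
                     map_smul' := fun c x => ext_inner A fun ζ => ?_ }
            adj_act := fun x a => ext_inner A fun ζ => ?_
            inner_map := fun ξ x => hI x ξ }, rfl, hS⟩
  · rw [IsHilbertModule.inner_add_right, ← hI, ← hI, ← hI]
    refine tendsto_nhds_unique (stdModule_inner_tendsto _ _)
      (((stdModule_inner_tendsto _ x).add (stdModule_inner_tendsto _ y)).congr fun N => ?_)
    simp [mul_add, Finset.sum_add_distrib]
  · rw [RingHom.id_apply, IsHilbertModule.inner_smul_right, ← hI, ← hI]
    have hc : Continuous fun a : A => c • a :=
      (IsProCStarAlgebra.withSeminorms (A := A)).continuousSMul.continuous_smul.comp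
        (continuous_const.prodMk continuous_id)
    refine tendsto_nhds_unique (stdModule_inner_tendsto _ _)
      (((hc.tendsto _).comp (stdModule_inner_tendsto _ x)).congr fun N => ?_)
    simp [Finset.smul_sum, mul_smul_comm]
  · change inner A ζ (S (x <• a)) = inner A ζ (S x <• a)
    rw [inner_act_right, ← hI, ← hI]
    refine tendsto_nhds_unique (stdModule_inner_tendsto _ _)
      (((stdModule_inner_tendsto _ x).mul_const a).congr fun N => ?_)
    rw [Finset.sum_mul]
    exact Finset.sum_congr rfl fun n _ => mul_assoc _ _ _

end FrameTransform

/-! ### Duality in terms of frame transforms. -/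

theorem proposition4p6 {A : Type u} {E : Type v}
    [NonUnitalRing A] [StarRing A] [Module ℂ A] [UniformSpace A] [IsProCStarAlgebra A]
    [AddCommGroup E] [Module ℂ E] [SMul Aᵐᵒᵖ E] [Inner A E] [UniformSpace E]
    [IsHilbertModule A E]
    (hE : CountablyGeneratedInMultipliers A E)
    (h t : ℕ → Multiplier A E) (hh : IsStandardFrame h) (ht : IsStandardFrame t) :
    ∃ θ₁ θ₂ : AdjointableMap A E (stdModule A),
      θ₁.toMap = frameTransform h hh ∧ θ₂.toMap = frameTransform t ht ∧
      ((IsDualFrame h t ∧ IsDualFrame t h) ↔ θ₁.adj ∘ₗ θ₂.toMap = LinearMap.id) := by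
  obtain ⟨θ₁, e₁, l₁⟩ := hh.exists_adjointable_frameTransform
  obtain ⟨θ₂, e₂, l₂⟩ := ht.exists_adjointable_frameTransform
  refine ⟨θ₁, θ₂, e₁, e₂, fun hd => ?_, fun hid => ?_⟩
  · refine LinearMap.ext fun ξ => IsHilbertModule.ext_inner A fun ζ => ?_
    -- The coordinates of `θ₂ ξ` are `⟪t n, ξ⟫`, so this series is the reconstruction series, whose
    -- limit is `ξ` by duality.
    have l := l₁ (θ₂.toMap ξ)
    rw [e₂] at l
    rw [LinearMap.comp_apply, LinearMap.id_apply, e₂]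
    exact tendsto_nhds_unique (IsHilbertModule.tendsto_inner_right ζ l)
      (IsHilbertModule.tendsto_inner_right ζ (hd.1.2.2 ξ))
  · have h12 : ∀ ξ, θ₁.adj (θ₂.toMap ξ) = ξ := LinearMap.congr_fun hid
    have hstar : ∀ x y : stdModule A, star (inner A x y) = inner A y x := fun x y =>
      tendsto_nhds_unique ((stdModule_inner_tendsto x y).star.congr fun N => by simp)
        (stdModule_inner_tendsto y x)
    -- This is `θ₂⋆ θ₁ = (θ₁⋆ θ₂)⋆ = id`, tested against `ζ`: `⟪θ₂ ζ, θ₁ ξ⟫ = ⟪ξ, θ₁⋆ θ₂ ζ⟫⋆ = ⟪ζ,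
    -- ξ⟫`.
    have h21 : ∀ ξ, θ₂.adj (θ₁.toMap ξ) = ξ := fun ξ => by
      refine IsHilbertModule.ext_inner A fun ζ => ?_
      rw [← θ₂.inner_map, ← hstar, θ₁.inner_map, h12, IsHilbertModule.star_inner]
    refine ⟨⟨hh, ht, fun ξ => ?_⟩, ⟨ht, hh, fun ξ => ?_⟩⟩
    · have l := l₁ (θ₂.toMap ξ)
      rw [h12, e₂] at l
      exact l
    · have l := l₂ (θ₁.toMap ξ)
      rw [h21, e₁] at l
      exact l
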